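/- Let $\{e_i\}_{i\ge 1}$ be the standard basis of the complex Hilbert space $\ell^2(\mathbb N)$, let $N_n$ ($n\ge 0$) be the orthogonal projection onto $\operatorname{span}\{e_1,\dots,e_n\}$ (so $N_0=0$), and let $\mathcal T(\mathbb N)$ be the algebra of all bounded operators on $\ell^2(\mathbb N)$ that leave the range of every $N_n$ invariant (the upper triangular operators). Let $$\mathcal I_\infty := \Bigl\{X\in\mathcal T(\mathbb N) : \inf_{n\ge 0}\,\|(I-N_n)X(I-N_n)\| = 0\Bigr\},$$ the diagonal ideal of $\mathcal T(\mathbb N)$ at $I$; it coincides with the set of compact operators in $\mathcal T(\mathbb N)$. Let $\mathcal P$ be a (left) primitive ideal of $\mathcal T(\mathbb N)$, i.e. a two-sided ideal that is the annihilator of a simple left $\mathcal T(\mathbb N)$-module, and suppose that $\mathcal P\supsetneq\mathcal I_\infty$. Then there is a strictly increasing sequence of non-negative integers $n_0<n_1<n_2<\cdots$ such that $\mathcal P$ contains $$\{X\in\mathcal T(\mathbb N) : (N_{n_k}-N_{n_{k-1}})X(N_{n_k}-N_{n_{k-1}})=0 \text{ for all } k\ge 1\}.$$ -/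

import Mathlib

open scoped ENNReal

noncomputable section

universe u

/-- The complex Hilbert space `ℓ²(ℕ)`. Its standard basis is indexed from `0` here. -/
abbrev EllTwo : Type := lp (fun _ : ℕ => ℂ) 2

/-- The standard basis vector with index `i`, where `i = 0, 1, 2, …`. -/
def stdVec (i : ℕ) : EllTwo := lp.single 2 i (1 : ℂ)

/-- The span of the first `n` standard basis vectors. -/
def initialSpan (n : ℕ) : Submodule ℂ EllTwo :=
  Submodule.span ℂ (Set.range fun i : Fin n => stdVec i)

instance (n : ℕ) : FiniteDimensional ℂ (initialSpan n) :=
  FiniteDimensional.span_of_finite ℂ (Set.finite_range _)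

/-- The orthogonal projection `N_n` of `ℓ²(ℕ)` onto the span of the first `n` standard basis
vectors (so `N_0 = 0`). -/
def nestProj (n : ℕ) : EllTwo →L[ℂ] EllTwo := (initialSpan n).starProjection

/-- `T(ℕ)`: the bounded operators on `ℓ²(ℕ)` which leave the range of every `N_n` invariant.
(The ranges of the remaining nest projections `0` and `I` are trivially invariant.) -/
def upperTriangular : Subalgebra ℂ (EllTwo →L[ℂ] EllTwo) where
  carrier := {X | ∀ n : ℕ, ∀ x ∈ initialSpan n, X x ∈ initialSpan n}
  mul_mem' := fun hX hY n x hx => hX n _ (hY n x hx)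
  add_mem' := fun hX hY n x hx => (initialSpan n).add_mem (hX n x hx) (hY n x hx)
  algebraMap_mem' := fun c n x hx => by
    simpa [Algebra.algebraMap_eq_smul_one] using (initialSpan n).smul_mem c hx

/-- The diagonal seminorm of `T(ℕ)` at the top `I` of the nest: the infimum of
`‖(I - M) X (I - M)‖` over the nest projections `M < I`, which are the `N_n`, `n = 0, 1, 2, …`. -/
def diagSeminormTop (X : upperTriangular) : ℝ :=
  ⨅ n : ℕ, ‖(1 - nestProj n) * (X : EllTwo →L[ℂ] EllTwo) * (1 - nestProj n)‖

/-- The diagonal ideal `I_∞` of `T(ℕ)`, as a set. -/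
def diagIdealInfty : Set upperTriangular := {X | diagSeminormTop X = 0}

/-- A two-sided ideal of a ring is (left) primitive if it is the annihilator of a simple
left module. (Every simple left `R`-module is isomorphic to a quotient of `R`, so it is enough to
take modules in the universe of `R`.) -/
def IsPrimitiveIdeal {R : Type u} [Ring R] (P : TwoSidedIdeal R) : Prop :=
  ∃ (M : Type u) (_ : AddCommGroup M) (_ : Module R M),
    IsSimpleModule R M ∧ ∀ a : R, a ∈ P ↔ ∀ m : M, a • m = 0

end

/-! Some `X ∈ P` is not in the diagonal ideal. Its corners stay bounded below, so there are disjoint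
intervals `[s p, s (p+1))` carrying vectors `x p`, `y p` with `⟨y p, X (x p)⟩ = 1` and `X (x p)`
nearly zero below `s p`. Compressing `X` by these vectors gives the identity plus a strictly upper
triangular `M` with summable columns.

Group the intervals into blocks ending at `n k = s (α k)`. If `S` has zero diagonal blocks, every `R
= S A S` moves each block two blocks down. The spare block leaves room to route `R` through the
vectors `x p`, `y p` by triangular factors (`exists_orthogonal_family`, `mem_of_almost_factors`), so
`R ∈ P` modulo the diagonal ideal. As this holds for every `A` and `P` is prime, `S ∈ P`. -/

theorem inner_stdVec_left (i : ℕ) (x : EllTwo) : inner ℂ (stdVec i) x = x i := by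
  simp [stdVec, lp.inner_single_left]

theorem stdVec_apply (i j : ℕ) : stdVec i j = if j = i then 1 else 0 := by
  simp [stdVec, lp.single_apply, Pi.single_apply]

theorem hasSum_smul_stdVec (x : EllTwo) : HasSum (fun i => x i • stdVec i) x := by
  have h := lp.hasSum_single (p := 2) (by simp) x
  convert h using 2 with i
  rw [stdVec, ← lp.single_smul, smul_eq_mul, mul_one]

theorem map_hasSum (T : EllTwo →L[ℂ] EllTwo) (x : EllTwo) :
    HasSum (fun i => x i • T (stdVec i)) (T x) := by
  simpa using (hasSum_smul_stdVec x).mapL T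

theorem map_mem_of_forall {W : Submodule ℂ EllTwo} (hW : IsClosed (W : Set EllTwo))
    {T : EllTwo →L[ℂ] EllTwo} {x : EllTwo} (h : ∀ i, x i ≠ 0 → T (stdVec i) ∈ W) : T x ∈ W := by
  refine hW.mem_of_tendsto (map_hasSum T x) (Filter.Eventually.of_forall fun s => ?_)
  refine W.sum_mem fun i _ => ?_
  by_cases hi : x i = 0
  · simp [hi]
  · exact W.smul_mem _ (h i hi)

theorem isClosed_initialSpan (n : ℕ) : IsClosed (initialSpan n : Set EllTwo) :=
  (initialSpan n).closed_of_finiteDimensional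

theorem stdVec_mem_initialSpan {i n : ℕ} (h : i < n) : stdVec i ∈ initialSpan n :=
  Submodule.subset_span ⟨⟨i, h⟩, rfl⟩

theorem mem_initialSpan_iff {n : ℕ} {x : EllTwo} : x ∈ initialSpan n ↔ ∀ i, n ≤ i → x i = 0 := by
  refine ⟨fun hx i hi => ?_, fun h => ?_⟩
  · induction hx using Submodule.span_induction with
    | mem y hy =>
      obtain ⟨j, rfl⟩ := hy
      have := j.2
      simp [stdVec_apply, show i ≠ j by omega]
    | zero => simp
    | add y z _ _ hy hz => simp [hy, hz]
    | smul c y _ hy => simp [hy]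
  · refine map_mem_of_forall (T := 1) (isClosed_initialSpan n) fun i hi => ?_
    exact stdVec_mem_initialSpan (lt_of_not_ge fun hn => hi (h i hn))

theorem initialSpan_mono {m n : ℕ} (h : m ≤ n) : initialSpan m ≤ initialSpan n := fun _ hx =>
  mem_initialSpan_iff.2 fun i hi => mem_initialSpan_iff.1 hx i (h.trans hi)

theorem nestProj_mem (n : ℕ) (x : EllTwo) : nestProj n x ∈ initialSpan n :=
  Submodule.starProjection_apply_mem _ x

theorem nestProj_apply (n : ℕ) (x : EllTwo) (i : ℕ) :
    nestProj n x i = if i < n then x i else 0 := by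
  split_ifs with h
  · have := (initialSpan n).starProjection_inner_eq_zero x (stdVec i) (stdVec_mem_initialSpan h)
    rw [← inner_conj_symm, inner_stdVec_left, map_eq_zero, lp.coeFn_sub, Pi.sub_apply,
      sub_eq_zero] at this
    exact this.symm
  · exact mem_initialSpan_iff.1 (nestProj_mem n x) i (not_lt.1 h)

theorem nestProj_eq_self {n : ℕ} {x : EllTwo} (h : x ∈ initialSpan n) : nestProj n x = x :=
  Submodule.starProjection_eq_self_iff.2 h

theorem nestProj_eq_zero {n : ℕ} {x : EllTwo} (h : ∀ i < n, x i = 0) : nestProj n x = 0 := by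
  ext i
  simp +contextual [nestProj_apply, h]

theorem norm_nestProj_apply_le (n : ℕ) (x : EllTwo) : ‖nestProj n x‖ ≤ ‖x‖ :=
  Submodule.norm_starProjection_apply_le _ x

theorem norm_sub_nestProj_apply_le (n : ℕ) (x : EllTwo) : ‖x - nestProj n x‖ ≤ ‖x‖ := by
  refine lp.norm_mono (p := 2) (by simp) fun i => ?_
  rw [lp.coeFn_sub, Pi.sub_apply, nestProj_apply]
  split_ifs <;> simp

theorem inner_nestProj_left (n : ℕ) (x y : EllTwo) :
    inner ℂ (nestProj n x) y = inner ℂ x (nestProj n y) :=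
  Submodule.inner_starProjection_left_eq_right _ x y

theorem tendsto_nestProj (x : EllTwo) :
    Filter.Tendsto (fun n => nestProj n x) Filter.atTop (nhds x) := by
  convert (hasSum_smul_stdVec x).tendsto_sum_nat using 2 with n
  ext i
  rw [← inner_stdVec_left i (∑ i ∈ Finset.range n, x i • stdVec i)]
  simp [nestProj_apply, inner_stdVec_left, stdVec_apply]

theorem inner_eq_zero_of_disjoint {x y : EllTwo} (h : ∀ i, x i = 0 ∨ y i = 0) :
    inner ℂ x y = 0 := by
  rw [lp.inner_eq_tsum]
  convert tsum_zero with i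
  rcases h i with h | h <;> simp [h]

/-! ### Bounded operators from orthogonal families; membership in the diagonal ideal -/

/-- A bounded family of pairwise orthogonal vectors is the image of the standard basis under a
bounded operator. -/
theorem exists_clm_map_stdVec {u : ℕ → EllTwo} (hu : Pairwise fun i j => inner ℂ (u i) (u j) = 0)
    {C : ℝ} (hC : ∀ i, ‖u i‖ ≤ C) : ∃ T : EllTwo →L[ℂ] EllTwo, ∀ i, T (stdVec i) = u i := by
  have hC0 : 0 ≤ C := (norm_nonneg _).trans (hC 0)
  let G : ℕ → Submodule ℂ EllTwo := fun i => Submodule.span ℂ {u i}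
  have hG : OrthogonalFamily ℂ (fun i => G i) fun i => (G i).subtypeₗᵢ := by
    intro i j hij v w
    obtain ⟨a, ha⟩ := Submodule.mem_span_singleton.1 v.2
    obtain ⟨b, hb⟩ := Submodule.mem_span_singleton.1 w.2
    simp [← ha, ← hb, inner_smul_left, inner_smul_right, hu hij]
  let g : EllTwo → ∀ i, G i := fun c i => c i • ⟨u i, Submodule.mem_span_singleton_self _⟩
  have hg : ∀ c i, ‖g c i‖ ≤ ‖((C : ℂ) • c) i‖ := fun c i => by
    simp only [g, norm_smul, lp.coeFn_smul, Pi.smul_apply, Complex.norm_real, Real.norm_eq_abs,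
      abs_of_nonneg hC0]
    rw [mul_comm]
    exact mul_le_mul_of_nonneg_right (hC i) (norm_nonneg _)
  have hmem : ∀ c, Memℓp (g c) 2 := fun c => (lp.memℓp ((C : ℂ) • c)).mono' (hg c)
  let D : EllTwo →ₗ[ℂ] lp (fun i => G i) 2 :=
    { toFun := fun c => ⟨g c, hmem c⟩
      map_add' := fun c d => Subtype.ext (funext fun i => add_smul (c i) (d i) _)
      map_smul' := fun a c => Subtype.ext (funext fun i => mul_smul a (c i) _) }
  refine ⟨hG.linearIsometry.toContinuousLinearMap ∘L D.mkContinuous C fun c => ?_, fun i => ?_⟩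
  · refine (lp.norm_mono (p := 2) (by simp) (hg c)).trans ?_
    rw [norm_smul, Complex.norm_real, Real.norm_eq_abs, abs_of_nonneg hC0]
  · have : D (stdVec i) = lp.single 2 i ⟨u i, Submodule.mem_span_singleton_self _⟩ := by
      ext j
      rcases eq_or_ne j i with rfl | h
      · simp [D, g, stdVec_apply]
      · simp [D, g, stdVec_apply, h]
    simp [this, hG.linearIsometry_apply_single]

open ContinuousLinearMap in
theorem adjoint_apply_coord (T : EllTwo →L[ℂ] EllTwo) (v : EllTwo) (i : ℕ) :
    adjoint T v i = inner ℂ (T (stdVec i)) v := by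
  rw [← inner_stdVec_left, adjoint_inner_right]

theorem mem_diagIdealInfty {Y : upperTriangular}
    (h : ∀ ε > 0, ∃ n : ℕ, ∀ v : EllTwo,
      ‖Y.1 (v - nestProj n v) - nestProj n (Y.1 (v - nestProj n v))‖ ≤ ε * ‖v‖) :
    Y ∈ diagIdealInfty := by
  refine le_antisymm (le_of_forall_pos_le_add fun ε hε => ?_)
    (Real.iInf_nonneg fun n => norm_nonneg _)
  obtain ⟨n, hn⟩ := h ε hε
  rw [zero_add]
  refine ciInf_le_of_le ⟨0, ?_⟩ n (ContinuousLinearMap.opNorm_le_bound _ hε.le fun v => ?_)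
  · rintro _ ⟨n, rfl⟩
    exact norm_nonneg _
  · simpa using hn v

/-- Split `(1/4)^q` as `(1/2)^q * (1/2)^q`: for `q ≥ n` one factor supplies the decay `(1/2)^n`, the
other is summed. -/
theorem norm_sub_map_nestProj_le {T : EllTwo →L[ℂ] EllTwo} {C : ℝ}
    (hT : ∀ q, ‖T (stdVec q)‖ ≤ C * (1 / 4) ^ q) (n : ℕ) (v : EllTwo) :
    ‖T (v - nestProj n v)‖ ≤ C * ‖v‖ * (1 / 2) ^ n * 2 := by
  have hC : 0 ≤ C := by simpa using (norm_nonneg _).trans (hT 0)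
  refine HasSum.norm_le_of_bounded (map_hasSum T _)
    (hasSum_geometric_two.mul_left (C * ‖v‖ * (1 / 2) ^ n)) fun q => ?_
  rw [norm_smul, lp.coeFn_sub, Pi.sub_apply, nestProj_apply]
  split_ifs with h
  · simp only [sub_self, norm_zero, zero_mul]
    positivity
  · rw [sub_zero]
    have h1 : ((1 : ℝ) / 2) ^ q ≤ (1 / 2) ^ n :=
      pow_le_pow_of_le_one (by norm_num) (by norm_num) (not_lt.1 h)
    calc ‖v q‖ * ‖T (stdVec q)‖ ≤ ‖v‖ * (C * (1 / 4) ^ q) :=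
          mul_le_mul (lp.norm_apply_le_norm (by simp) v q) (hT q) (norm_nonneg _) (norm_nonneg _)
      _ = C * ‖v‖ * ((1 / 2) ^ q * (1 / 2) ^ q) := by
          rw [← mul_pow]; norm_num; ring
      _ ≤ C * ‖v‖ * ((1 / 2) ^ n * (1 / 2) ^ q) := by gcongr
      _ = _ := by ring

/-! ### Factoring through an element of the ideal -/

open ContinuousLinearMap in
/-- Let `P` contain the diagonal ideal and an operator `X` with localised almost-biorthogonal vectors
`x p`, `y p`. Then `P` contains every `R` supported on an orthogonal family `f` such that the `p`-th
block separates the vectors `f p` from their images `R (f p)`: up to the diagonal ideal, `R` is the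
product `(∑ R (f p) ⊗ y p) X (∑ x p ⊗ f p)`. -/
theorem mem_of_almost_factors {P : TwoSidedIdeal upperTriangular}
    (hP : diagIdealInfty ⊆ (P : Set upperTriangular)) {X : upperTriangular} (hX : X ∈ P)
    {s : ℕ → ℕ} (hs : StrictMono s) {x y : ℕ → EllTwo} {C : ℝ}
    (hx : ∀ p, x p ∈ initialSpan (s (p + 1))) (hx0 : ∀ p, ∀ i < s p, x p i = 0)
    (hy : ∀ p, y p ∈ initialSpan (s (p + 1))) (hy0 : ∀ p, ∀ i < s p, y p i = 0)
    (hxn : ∀ p, ‖x p‖ ≤ 1) (hyn : ∀ p, ‖y p‖ ≤ C)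
    (hxy : ∀ p, inner ℂ (y p) (X.1 (x p)) = 1)
    (hsmall : ∀ p, ‖nestProj (s p) (X.1 (x p))‖ ≤ (1 / 4) ^ p)
    {R : upperTriangular} {f : ℕ → EllTwo}
    (hf : Pairwise fun i j => inner ℂ (f i) (f j) = 0) (hf1 : ∀ p, f p = 0 ∨ ‖f p‖ = 1)
    (hf0 : ∀ p, ∀ i < s (p + 1), f p i = 0) (hRf : ∀ p, R.1 (f p) ∈ initialSpan (s p))
    (hR : ∀ v, (∀ p, inner ℂ (f p) v = 0) → R.1 v = 0) : R ∈ P := by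
  have key : ∀ u : ℕ → EllTwo, (∀ p, u p ∈ initialSpan (s (p + 1))) →
      (∀ p, ∀ i < s p, u p i = 0) → Pairwise fun i j => inner ℂ (u i) (u j) = 0 := by
    intro u hu hu0
    have aux : ∀ i j, i < j → ∀ k, u i k = 0 ∨ u j k = 0 := fun i j hij k => by
      rcases lt_or_ge k (s (i + 1)) with h | h
      · exact Or.inr (hu0 j k (h.trans_le (hs.monotone hij)))
      · exact Or.inl (mem_initialSpan_iff.1 (hu i) k h)
    intro i j hij
    rcases lt_or_gt_of_ne hij with h | h
    · exact inner_eq_zero_of_disjoint (aux i j h)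
    · exact inner_eq_zero_of_disjoint fun k => (aux j i h k).symm
  obtain ⟨Φx, hΦx⟩ := exists_clm_map_stdVec (key x hx hx0) hxn
  obtain ⟨Φy, hΦy⟩ := exists_clm_map_stdVec (key y hy hy0) hyn
  obtain ⟨Φf, hΦf⟩ := exists_clm_map_stdVec (C := 1) hf fun p => by
    rcases hf1 p with h | h <;> simp [h]
  classical
  -- `Φf Φf*` is the projection onto the closed span of the `f p`, and `R` vanishes on the
  -- orthogonal complement.
  have hRΦ : ∀ v, R.1 (Φf (adjoint Φf v)) = R.1 v := by
    intro v
    rw [← sub_eq_zero, ← map_sub]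
    refine hR _ fun p => ?_
    have h1 : adjoint Φf (f p) = (if f p = 0 then (0 : ℂ) else 1) • stdVec p := by
      ext i
      rw [adjoint_apply_coord, hΦf, lp.coeFn_smul, Pi.smul_apply, stdVec_apply]
      rcases eq_or_ne i p with rfl | hip
      · rcases hf1 i with h | h
        · simp [h]
        · have : f i ≠ 0 := fun h0 => by simp [h0] at h
          simp [this, inner_self_eq_norm_sq_to_K, h]
      · simp [hip, hf hip]
    have h2 : inner ℂ (f p) v = adjoint Φf v p := by rw [adjoint_apply_coord, hΦf]
    rw [inner_sub_right, h2, ← adjoint_inner_left, h1]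
    split_ifs with h
    · simp [adjoint_apply_coord, hΦf, h]
    · simp [inner_stdVec_left]
  have hA : R.1 * Φf * adjoint Φy ∈ upperTriangular := by
    intro n v hv
    refine map_mem_of_forall (T := R.1 * Φf) (isClosed_initialSpan n) fun p hp => ?_
    rw [mul_apply_eq_comp, hΦf]
    refine initialSpan_mono (le_of_not_gt fun hn => hp ?_) (hRf p)
    refine (adjoint_apply_coord _ _ _).trans ?_
    rw [hΦy]
    refine inner_eq_zero_of_disjoint fun i => ?_
    rcases lt_or_ge i (s p) with h | h
    · exact Or.inl (hy0 p i h)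
    · exact Or.inr (mem_initialSpan_iff.1 hv i (hn.le.trans h))
  have hB : Φx * adjoint Φf ∈ upperTriangular := by
    intro n v hv
    refine map_mem_of_forall (T := Φx) (isClosed_initialSpan n) fun p hp => ?_
    rw [hΦx]
    refine initialSpan_mono (le_of_not_gt fun hn => hp ?_) (hx p)
    refine (adjoint_apply_coord _ _ _).trans ?_
    rw [hΦf]
    refine inner_eq_zero_of_disjoint fun i => ?_
    rcases lt_or_ge i (s (p + 1)) with h | h
    · exact Or.inl (hf0 p i h)
    · exact Or.inr (mem_initialSpan_iff.1 hv i (hn.le.trans h))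
  set M : EllTwo →L[ℂ] EllTwo := adjoint Φy * X.1 * Φx - 1 with hM
  -- The entry `(p, q)` of `Φy* X Φx` is `1` for `p = q`, and `0` for `p > q` since `X` is
  -- triangular. Only rows `p < q` survive in `M`, and these see only the part of `X (x q)` below `s
  -- q`.
  have hMe : ∀ q, M (stdVec q) = adjoint Φy (nestProj (s q) (X.1 (x q))) := by
    intro q
    ext p
    rw [adjoint_apply_coord, hΦy, ← inner_nestProj_left, hM, sub_apply,
      lp.coeFn_sub, Pi.sub_apply, mul_apply_eq_comp, mul_apply_eq_comp,
      hΦx, adjoint_apply_coord, hΦy, one_apply_eq_self, stdVec_apply]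
    rcases lt_trichotomy p q with h | rfl | h
    · rw [nestProj_eq_self (initialSpan_mono (hs.monotone h) (hy p)), if_neg h.ne, sub_zero]
    · rw [nestProj_eq_zero (hy0 p), hxy]
      simp
    · rw [nestProj_eq_zero fun i hi => hy0 p i (hi.trans (hs h)), if_neg h.ne',
        ← nestProj_eq_self (X.2 _ _ (hx q)), ← inner_nestProj_left,
        nestProj_eq_zero fun i hi => hy0 p i (hi.trans_le (hs.monotone h))]
      simp
  have hMn : ∀ q, ‖M (stdVec q)‖ ≤ ‖adjoint Φy‖ * (1 / 4) ^ q := fun q => by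
    rw [hMe]
    exact (le_opNorm _ _).trans (mul_le_mul_of_nonneg_left (hsmall q) (norm_nonneg _))
  have hMtri : ∀ n, ∀ v ∈ initialSpan n, M v ∈ initialSpan n := by
    intro n v hv
    refine map_mem_of_forall (isClosed_initialSpan n) fun q hq => ?_
    have hqn : q < n := lt_of_not_ge fun h => hq (mem_initialSpan_iff.1 hv q h)
    rw [hMe, mem_initialSpan_iff]
    intro p hp
    rw [adjoint_apply_coord, hΦy, ← inner_nestProj_left,
      nestProj_eq_zero fun i hi => hy0 p i (hi.trans (hs (hqn.trans_le hp))), inner_zero_left]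
  have hK : (⟨_, hA⟩ * X * ⟨_, hB⟩ - R : upperTriangular) ∈ diagIdealInfty := by
    refine mem_diagIdealInfty fun ε hε => ?_
    have hval : ∀ v, (⟨_, hA⟩ * X * ⟨_, hB⟩ - R : upperTriangular).1 v =
        R.1 (Φf (M (adjoint Φf v))) := by
      intro v
      change R.1 (Φf (adjoint Φy (X.1 (Φx (adjoint Φf v))))) - R.1 v = _
      simp [hM, hRΦ]
    set c : ℝ := ‖R.1‖ * ‖Φf‖ * ‖adjoint Φy‖ * ‖adjoint Φf‖ * 2 with hc
    obtain ⟨n, hn⟩ : ∃ n : ℕ, c * (1 / 2) ^ n < ε := by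
      have := (tendsto_pow_atTop_nhds_zero_of_lt_one (r := (1 / 2 : ℝ)) (by norm_num)
        (by norm_num)).const_mul c
      rw [mul_zero] at this
      exact (this.eventually (gt_mem_nhds hε)).exists
    refine ⟨s n, fun v => ?_⟩
    rw [hval]
    set w := v - nestProj (s n) v with hw
    set z := adjoint Φf w
    -- The first `n` coordinates of `z` contribute only inside the range of `N_{s n}`, which the
    -- left cutoff removes; the tail is small by the decay of the columns of `M`.
    have hz : R.1 (Φf (M (nestProj n z))) ∈ initialSpan (s n) := by
      refine map_mem_of_forall (T := R.1 * Φf) (isClosed_initialSpan _) fun p hp => ?_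
      rw [mul_apply_eq_comp, hΦf]
      refine initialSpan_mono (hs.monotone (le_of_not_gt fun hnp => hp ?_)) (hRf p)
      exact mem_initialSpan_iff.1 (hMtri n _ (nestProj_mem n z)) p hnp.le
    have hsplit : R.1 (Φf (M z)) - nestProj (s n) (R.1 (Φf (M z))) =
        R.1 (Φf (M (z - nestProj n z))) -
          nestProj (s n) (R.1 (Φf (M (z - nestProj n z)))) := by
      simp only [map_sub, nestProj_eq_self hz]
      abel
    rw [hsplit]
    calc _ ≤ ‖R.1 (Φf (M (z - nestProj n z)))‖ := norm_sub_nestProj_apply_le _ _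
      _ ≤ ‖R.1‖ * (‖Φf‖ * (‖adjoint Φy‖ * (‖adjoint Φf‖ * ‖v‖) * (1 / 2) ^ n * 2)) := by
        refine (le_opNorm _ _).trans ?_
        gcongr
        refine (le_opNorm _ _).trans ?_
        gcongr
        refine (norm_sub_map_nestProj_le hMn n z).trans ?_
        gcongr
        refine (le_opNorm _ _).trans ?_
        gcongr
        exact norm_sub_nestProj_apply_le _ _
      _ = (c * (1 / 2) ^ n) * ‖v‖ := by rw [hc]; ring
      _ ≤ ε * ‖v‖ := by gcongr
  have hAXB : (⟨_, hA⟩ * X * ⟨_, hB⟩ : upperTriangular) ∈ P :=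
    P.mul_mem_right _ _ (P.mul_mem_left _ _ hX)
  simpa using P.sub_mem hAXB (hP hK)

/-! ### Localised vectors for an operator outside the diagonal ideal -/

open ContinuousLinearMap Filter in
theorem exists_bump {X : upperTriangular} {δ : ℝ} (hδ : 0 < δ)
    (hX : ∀ n, δ ≤ ‖(1 - nestProj n) * X.1 * (1 - nestProj n)‖) (a : ℕ) {ε : ℝ} (hε : 0 < ε) :
    ∃ (b : ℕ) (x y : EllTwo), a < b ∧ x ∈ initialSpan b ∧ (∀ i < a, x i = 0) ∧
      y ∈ initialSpan b ∧ (∀ i < a, y i = 0) ∧ ‖x‖ ≤ 1 ∧ ‖y‖ ≤ 2 / δ ∧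
      inner ℂ y (X.1 x) = 1 ∧ ‖nestProj a (X.1 x)‖ ≤ ε := by
  -- The rows `X* e_i`, `i < a`, have small tails beyond `n`; any `x` of norm at most `1` supported
  -- beyond `n` then has `N_a X x` small.
  obtain ⟨n, han, hn⟩ : ∃ n, a ≤ n ∧ ∑ i ∈ Finset.range a,
      ‖adjoint X.1 (stdVec i) - nestProj n (adjoint X.1 (stdVec i))‖ < ε := by
    have h : Tendsto (fun n => ∑ i ∈ Finset.range a,
        ‖adjoint X.1 (stdVec i) - nestProj n (adjoint X.1 (stdVec i))‖) atTop (nhds 0) := by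
      rw [← Finset.sum_const_zero (s := Finset.range a)]
      refine tendsto_finsetSum _ fun i _ => ?_
      simpa using ((tendsto_nestProj (adjoint X.1 (stdVec i))).const_sub
        (adjoint X.1 (stdVec i))).norm
    exact ((eventually_ge_atTop a).and (h.eventually (gt_mem_nhds hε))).exists
  obtain ⟨v, hv1, hv⟩ := exists_lt_apply_of_lt_opNorm _ ((half_lt_self hδ).trans_le (hX n))
  obtain ⟨m, hnm, hm⟩ : ∃ m, n < m ∧
      δ / 2 < ‖((1 - nestProj n) * X.1 * (1 - nestProj n)) (nestProj m v)‖ :=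
    ((eventually_gt_atTop n).and ((((((1 - nestProj n) * X.1 *
      (1 - nestProj n)).continuous.tendsto v).comp (tendsto_nestProj v)).norm).eventually
        (lt_mem_nhds hv))).exists
  set x := nestProj m v - nestProj n (nestProj m v) with hx
  set z := X.1 x - nestProj n (X.1 x) with hz
  have hzn : δ / 2 < ‖z‖ := hm
  have hz0 : 0 < ‖z‖ := (half_pos hδ).trans hzn
  have hxm : x ∈ initialSpan m :=
    (initialSpan m).sub_mem (nestProj_mem _ _) (initialSpan_mono hnm.le (nestProj_mem _ _))
  have hsub : ∀ u : EllTwo, ∀ i < n, (u - nestProj n u) i = 0 := fun u i hi => by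
    rw [lp.coeFn_sub, Pi.sub_apply, nestProj_apply, if_pos hi, sub_self]
  have hx1 : ‖x‖ ≤ 1 :=
    (norm_sub_nestProj_apply_le _ _).trans ((norm_nestProj_apply_le _ _).trans hv1.le)
  -- Scaling by `‖z‖⁻²` makes the pairing exactly `1`; then `‖y‖ = ‖z‖⁻¹ ≤ 2 / δ`.
  refine ⟨m, x, ((‖z‖ ^ 2)⁻¹ : ℂ) • z, han.trans_lt hnm, hxm, fun i hi => hsub _ i (hi.trans_le han),
    (initialSpan m).smul_mem _ ((initialSpan m).sub_mem (X.2 _ _ hxm)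
      (initialSpan_mono hnm.le (nestProj_mem _ _))), fun i hi => ?_, hx1, ?_, ?_, ?_⟩
  · rw [lp.coeFn_smul, Pi.smul_apply, hsub _ i (hi.trans_le han), smul_zero]
  · rw [norm_smul, norm_inv, norm_pow, Complex.norm_real, norm_norm, pow_two, mul_inv, mul_assoc,
      inv_mul_cancel₀ hz0.ne', mul_one, inv_le_comm₀ hz0 (by positivity), inv_div]
    exact hzn.le
  · have h1 : inner ℂ z (X.1 x) = inner ℂ z z := by
      conv_rhs => rw [hz, inner_sub_right, ← hz, ← inner_nestProj_left,
        nestProj_eq_zero (hsub (X.1 x)), inner_zero_left, sub_zero]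
    rw [inner_smul_left, h1, inner_self_eq_norm_sq_to_K]
    have : (‖z‖ : ℂ) ≠ 0 := by exact_mod_cast hz0.ne'
    simp [this]
  · have h1 : nestProj a (X.1 x) = ∑ i ∈ Finset.range a, X.1 x i • stdVec i := by
      ext i
      rw [← inner_stdVec_left i (∑ i ∈ Finset.range a, X.1 x i • stdVec i)]
      simp [nestProj_apply, inner_stdVec_left, stdVec_apply]
    rw [h1]
    refine (norm_sum_le _ _).trans ((Finset.sum_le_sum fun i _ => ?_).trans hn.le)
    have h2 : X.1 x i =
        inner ℂ (adjoint X.1 (stdVec i) - nestProj n (adjoint X.1 (stdVec i))) x := by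
      rw [inner_sub_left, inner_nestProj_left, nestProj_eq_zero (hsub _), inner_zero_right,
        sub_zero, adjoint_inner_left, inner_stdVec_left]
    have h3 : ‖stdVec i‖ = 1 := by simp [stdVec, lp.norm_single]
    rw [norm_smul, h3, mul_one, h2]
    exact (norm_inner_le_norm _ _).trans (mul_le_of_le_one_right (norm_nonneg _) hx1)

theorem exists_bump_seq {X : upperTriangular} (hX : X ∉ diagIdealInfty) :
    ∃ (s : ℕ → ℕ) (x y : ℕ → EllTwo) (C : ℝ), StrictMono s ∧ s 0 = 0 ∧
      (∀ p, x p ∈ initialSpan (s (p + 1))) ∧ (∀ p, ∀ i < s p, x p i = 0) ∧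
      (∀ p, y p ∈ initialSpan (s (p + 1))) ∧ (∀ p, ∀ i < s p, y p i = 0) ∧
      (∀ p, ‖x p‖ ≤ 1) ∧ (∀ p, ‖y p‖ ≤ C) ∧ (∀ p, inner ℂ (y p) (X.1 (x p)) = 1) ∧
      ∀ p, ‖nestProj (s p) (X.1 (x p))‖ ≤ (1 / 4) ^ p := by
  have hδ : 0 < diagSeminormTop X :=
    lt_of_le_of_ne (Real.iInf_nonneg fun n => norm_nonneg _) (Ne.symm hX)
  have hle : ∀ n, diagSeminormTop X ≤ ‖(1 - nestProj n) * X.1 * (1 - nestProj n)‖ := fun n =>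
    ciInf_le ⟨0, by rintro _ ⟨n, rfl⟩; exact norm_nonneg _⟩ n
  choose b x y h using fun a p : ℕ =>
    exists_bump hδ hle a (ε := (1 / 4) ^ p) (by positivity)
  let s : ℕ → ℕ := fun p => Nat.rec 0 (fun p a => b a p) p
  exact ⟨s, fun p => x (s p) p, fun p => y (s p) p, 2 / diagSeminormTop X,
    strictMono_nat_of_lt_succ fun p => (h (s p) p).1, rfl,
    fun p => (h (s p) p).2.1, fun p => (h (s p) p).2.2.1, fun p => (h (s p) p).2.2.2.1,
    fun p => (h (s p) p).2.2.2.2.1, fun p => (h (s p) p).2.2.2.2.2.1,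
    fun p => (h (s p) p).2.2.2.2.2.2.1, fun p => (h (s p) p).2.2.2.2.2.2.2.1,
    fun p => (h (s p) p).2.2.2.2.2.2.2.2⟩

/-! ### Orthogonal families adapted to the blocks -/

open InnerProductSpace in
-- Pairing the Gram-Schmidt expansion of `w j` with its own orthogonalised vector leaves only that
-- vector's squared norm.
theorem gramSchmidtNormed_eq_zero {w : ℕ → EllTwo} {j : ℕ} (h : w j = 0) :
    gramSchmidtNormed ℂ w j = 0 := by
  have h1 := congrArg (inner ℂ (gramSchmidt ℂ w j)) (gramSchmidt_def'' ℂ w j)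
  rw [h, inner_zero_right, inner_add_right, inner_sum, Finset.sum_eq_zero, add_zero, eq_comm,
    inner_self_eq_zero] at h1
  · simp [gramSchmidtNormed, h1]
  · intro i hi
    rw [inner_smul_right, gramSchmidt_orthogonal ℂ w (Finset.mem_Iio.1 hi).ne', mul_zero]

theorem exists_block {α : ℕ → ℕ} (hα : StrictMono α) (h0 : α 0 = 0) (p : ℕ) :
    ∃ k, α k ≤ p ∧ p < α (k + 1) := by
  induction p with
  | zero => exact ⟨0, h0.le, h0.symm.trans_lt (hα zero_lt_one)⟩
  | succ p ih =>
    obtain ⟨k, hk, hk'⟩ := ih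
    rcases lt_or_ge (p + 1) (α (k + 1)) with h | h
    · exact ⟨k, hk.trans p.le_succ, h⟩
    · exact ⟨k + 1, h, Nat.lt_of_le_of_lt hk' (hα (k + 1).lt_succ_self)⟩

open ContinuousLinearMap InnerProductSpace in
/-- An operator which moves each block at least two blocks down is supported on an orthogonal family
adapted to the sequence `s`, obtained by the Gram-Schmidt process in each block. -/
theorem exists_orthogonal_family {R : EllTwo →L[ℂ] EllTwo} {s α : ℕ → ℕ} (hs : StrictMono s)
    (hα : StrictMono α) (h0 : α 0 = 0) (hαs : ∀ k, α k + s (α k) ≤ α (k + 1))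
    (hR1 : ∀ v ∈ initialSpan (s (α 1)), R v = 0)
    (hR2 : ∀ k, ∀ v ∈ initialSpan (s (α (k + 2))), R v ∈ initialSpan (s (α k))) :
    ∃ f : ℕ → EllTwo, (Pairwise fun i j => inner ℂ (f i) (f j) = 0) ∧
      (∀ p, f p = 0 ∨ ‖f p‖ = 1) ∧ (∀ p, ∀ i < s (p + 1), f p i = 0) ∧
      (∀ p, R (f p) ∈ initialSpan (s p)) ∧ ∀ v, (∀ p, inner ℂ (f p) v = 0) → R v = 0 := by
  choose κ hκ hκ' using exists_block hα h0
  have hκu : ∀ p k, α k ≤ p → p < α (k + 1) → κ p = k := fun p k h h' => by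
    have h1 := hα.lt_iff_lt.1 ((hκ p).trans_lt h')
    have h2 := hα.lt_iff_lt.1 (h.trans_lt (hκ' p))
    omega
  have hn : StrictMono fun k => s (α k) := hs.comp hα
  let F : ℕ → EllTwo →L[ℂ] EllTwo := fun k =>
    nestProj (s (α (k + 2))) - nestProj (s (α (k + 1)))
  have hF : ∀ k v i, F k v i =
      if s (α (k + 1)) ≤ i ∧ i < s (α (k + 2)) then v i else 0 := fun k v i => by
    have : s (α (k + 1)) < s (α (k + 2)) := hn (Nat.lt_succ_self (k + 1))
    rw [show F k v = nestProj (s (α (k + 2))) v - nestProj (s (α (k + 1))) v from rfl,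
      lp.coeFn_sub, Pi.sub_apply, nestProj_apply, nestProj_apply]
    split_ifs <;> first | (exfalso; omega) | simp
  -- These vectors span the support of `R F_k`: `⟨w k j, v⟩` is the `j`-th coordinate of `R (F k
  -- v)`. Only `j < s (α k)` matter, so they fit into the indices `p ∈ [α k, α (k+1))` by `hαs`.
  let w : ℕ → ℕ → EllTwo := fun k j => F k (adjoint R (stdVec j))
  have hw0 : ∀ k j, s (α k) ≤ j → w k j = 0 := fun k j hj => by
    ext i
    rw [hF]
    split_ifs with h
    · rw [adjoint_apply_coord, ← inner_conj_symm, inner_stdVec_left,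
        mem_initialSpan_iff.1 (hR2 k _ (stdVec_mem_initialSpan h.2)) j hj]
      simp
    · simp
  let g : ℕ → ℕ → EllTwo := fun k => gramSchmidtNormed ℂ (w k)
  have hspan : ∀ k, Submodule.span ℂ (Set.range (g k)) = Submodule.span ℂ (Set.range (w k)) :=
    fun k => (span_gramSchmidtNormed_range (w k)).trans (span_gramSchmidt ℂ (w k))
  have hg0 : ∀ k j i, ¬ (s (α (k + 1)) ≤ i ∧ i < s (α (k + 2))) → g k j i = 0 := by
    intro k j i hi
    have : g k j ∈ Submodule.span ℂ (Set.range (w k)) :=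
      hspan k ▸ Submodule.subset_span ⟨j, rfl⟩
    generalize g k j = u at this
    induction this using Submodule.span_induction with
    | mem y hy =>
      obtain ⟨j, rfl⟩ := hy
      rw [hF, if_neg hi]
    | zero => simp
    | add y z _ _ hy hz => rw [lp.coeFn_add, Pi.add_apply, hy, hz, add_zero]
    | smul c y _ hy => rw [lp.coeFn_smul, Pi.smul_apply, hy, smul_zero]
  -- For `p` in the `k`-th index block, `f p` lives one block further, in `[s (α (k+1)), s (α
  -- (k+2)))`. Hence it starts beyond `s (p+1)`, while `R (f p)` lies below `s (α k) ≤ s p`.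
  refine ⟨fun p => g (κ p) (p - α (κ p)), fun p q hpq => ?_, fun p => ?_, fun p i hi => ?_,
    fun p => ?_, fun v hv => ?_⟩
  · rcases eq_or_ne (κ p) (κ q) with h | h
    · have hp := hκ p
      have hq := hκ q
      simp only [h] at hp ⊢
      have hne : p - α (κ q) ≠ q - α (κ q) := by omega
      simp [g, gramSchmidtNormed, gramSchmidt_orthogonal ℂ (w (κ q)) hne]
    · refine inner_eq_zero_of_disjoint fun i => ?_
      by_contra! hc
      have hp := not_imp_comm.1 (hg0 _ _ i) hc.1
      have hq := not_imp_comm.1 (hg0 _ _ i) hc.2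
      have h1 := hn.lt_iff_lt.1 (hp.1.trans_lt hq.2)
      have h2 := hn.lt_iff_lt.1 (hq.1.trans_lt hp.2)
      omega
  · exact or_iff_not_imp_left.2 fun h => gramSchmidtNormed_unit_length' h
  · exact hg0 _ _ _ fun h => absurd (hi.trans_le (hs.monotone (hκ' p))) (not_lt.2 h.1)
  · refine initialSpan_mono (hs.monotone (hκ p)) (hR2 _ _ (mem_initialSpan_iff.2 fun i hi => ?_))
    exact hg0 _ _ _ fun h => absurd h.2 (not_lt.2 hi)
  · have hgv : ∀ k j, inner ℂ (g k j) v = 0 := fun k j => by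
      rcases lt_or_ge j (s (α k)) with hj | hj
      · have : inner ℂ (g (κ (α k + j)) (α k + j - α (κ (α k + j)))) v = 0 := hv (α k + j)
        rwa [hκu (α k + j) k (by omega) (by have := hαs k; omega), Nat.add_sub_cancel_left] at this
      · rw [show g k j = 0 from gramSchmidtNormed_eq_zero (hw0 k j hj), inner_zero_left]
    have hwv : ∀ k j, inner ℂ (w k j) v = 0 := fun k j => by
      have : w k j ∈ Submodule.span ℂ (Set.range (g k)) :=
        (hspan k).symm ▸ Submodule.subset_span ⟨j, rfl⟩
      generalize w k j = u at this
      induction this using Submodule.span_induction with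
      | mem y hy =>
        obtain ⟨j, rfl⟩ := hy
        exact hgv k j
      | zero => simp
      | add y z _ _ hy hz => rw [inner_add_left, hy, hz, add_zero]
      | smul c y _ hy => rw [inner_smul_left, hy, mul_zero]
    have hRF : ∀ k, R (F k v) = 0 := fun k => by
      ext j
      have := hwv k j
      rw [show w k j = nestProj (s (α (k + 2))) (adjoint R (stdVec j)) -
        nestProj (s (α (k + 1))) (adjoint R (stdVec j)) from rfl, inner_sub_left,
        inner_nestProj_left, inner_nestProj_left, ← inner_sub_right, adjoint_inner_left,
        inner_stdVec_left] at this
      exact this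
    have hRN : ∀ k, R (nestProj (s (α (k + 1))) v) = 0 := fun k => by
      induction k with
      | zero => exact hR1 _ (nestProj_mem _ _)
      | succ k ih =>
        have := hRF k
        rw [show F k v = nestProj (s (α (k + 2))) v - nestProj (s (α (k + 1))) v from rfl,
          map_sub, ih, sub_zero] at this
        exact this
    have h1 := (R.continuous.tendsto v).comp ((tendsto_nestProj v).comp
      (hn.tendsto_atTop.comp (Filter.tendsto_add_atTop_nat 1)))
    refine tendsto_nhds_unique h1 ?_
    simp [Function.comp_def, hRN]

/-! ### Primeness and conclusion -/

/-- Primitive ideals are prime. -/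
theorem exists_mul_mul_notMem {P : TwoSidedIdeal upperTriangular} (hP : IsPrimitiveIdeal P)
    {S : upperTriangular} (hS : S ∉ P) : ∃ A, S * A * S ∉ P := by
  obtain ⟨M, _, _, hM, h⟩ := hP
  rw [h] at hS
  push Not at hS
  obtain ⟨m, hm⟩ := hS
  -- By simplicity `S m ≠ 0` generates the module, so some `A` has `A S m = m`, and `S A S m = S m ≠
  -- 0`.
  obtain ⟨A, hA⟩ := IsSimpleModule.toSpanSingleton_surjective upperTriangular hm m
  refine ⟨A, fun hc => hm ?_⟩
  have := (h _).1 hc m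
  rwa [mul_smul, mul_smul, show A • S • m = m from hA] at this

theorem map_mem_initialSpan_of_block_eq_zero {S : upperTriangular} {a b : ℕ}
    (h : (nestProj b - nestProj a) * S.1 * (nestProj b - nestProj a) = 0) {v : EllTwo}
    (hv : v ∈ initialSpan b) (hab : a ≤ b) : S.1 v ∈ initialSpan a := by
  have h1 := DFunLike.congr_fun h v
  have h2 : nestProj b (S.1 (nestProj b v - nestProj a v)) =
      nestProj a (S.1 (nestProj b v - nestProj a v)) := by
    simpa [sub_eq_zero] using h1
  have h3 : nestProj b v - nestProj a v ∈ initialSpan b :=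
    Submodule.sub_mem _ (nestProj_mem _ _) (initialSpan_mono hab (nestProj_mem _ _))
  rw [nestProj_eq_self (S.2 _ _ h3), nestProj_eq_self hv] at h2
  have h4 : S.1 v = S.1 (v - nestProj a v) + S.1 (nestProj a v) := by simp
  rw [h4, h2]
  exact Submodule.add_mem _ (nestProj_mem _ _) (S.2 _ _ (nestProj_mem _ _))

theorem mainTheorem10 (P : TwoSidedIdeal upperTriangular) (hP : IsPrimitiveIdeal P)
    (hlt : diagIdealInfty ⊂ (P : Set upperTriangular)) :
    ∃ n : ℕ → ℕ, StrictMono n ∧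
      ∀ X : upperTriangular,
        (∀ k : ℕ, (nestProj (n (k + 1)) - nestProj (n k)) * (X : EllTwo →L[ℂ] EllTwo) *
          (nestProj (n (k + 1)) - nestProj (n k)) = 0) → X ∈ P := by
  obtain ⟨X, hXP, hX⟩ := Set.exists_of_ssubset hlt
  obtain ⟨s, x, y, C, hs, hs0, hx, hx0, hy, hy0, hxn, hyn, hxy, hsmall⟩ := exists_bump_seq hX
  -- The block needs `s (α k)` indices, a bound on the rank of `R F_k`; the `+ 1` keeps `α` strictly
  -- increasing at `k = 0`, where `s 0 = 0`.
  let α : ℕ → ℕ := fun k => Nat.rec 0 (fun _ a => a + s a + 1) k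
  have hα1 : ∀ k, α (k + 1) = α k + s (α k) + 1 := fun _ => rfl
  have hα : StrictMono α := strictMono_nat_of_lt_succ fun k => by rw [hα1]; omega
  refine ⟨fun k => s (α k), hs.comp hα, fun S hS => ?_⟩
  by_contra hSP
  obtain ⟨A, hA⟩ := exists_mul_mul_notMem hP hSP
  have hS' : ∀ k, ∀ v ∈ initialSpan (s (α (k + 1))), S.1 v ∈ initialSpan (s (α k)) :=
    fun k v hv => map_mem_initialSpan_of_block_eq_zero (hS k) hv ((hs.comp hα).monotone k.le_succ)
  obtain ⟨f, hf, hf1, hf0, hRf, hR⟩ := exists_orthogonal_family (R := (S * A * S).1) hs hα rfl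
    (fun k => by rw [hα1]; omega)
    (fun v hv => by
      have h1 : S.1 v ∈ initialSpan 0 := by
        have := hS' 0 v hv
        rwa [show s (α 0) = 0 from hs0] at this
      have h2 : S.1 v = 0 := by
        ext i
        exact mem_initialSpan_iff.1 h1 i (Nat.zero_le i)
      change S.1 (A.1 (S.1 v)) = 0
      rw [h2, map_zero, map_zero])
    (fun k v hv => hS' k _ (A.2 _ _ (hS' (k + 1) v hv)))
  exact hA (mem_of_almost_factors hlt.subset hXP hs hx hx0 hy hy0 hxn hyn hxy hsmall hf hf1 hf0
    hRf hR)
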